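/- A \emph{quotient Borel space} is a pair $(X,E)$, with $X$ a standard Borel space and $E$ a countable Borel equivalence relation on $X$; its underlying set is $X/E$. A subset of $X/E$ is Borel if its preimage in $X$ is Borel. A relation $R\subseteq X/E\times Y/F$ between quotient Borel spaces $(X,E)$, $(Y,F)$ is Borel if its preimage in $X\times Y$ is Borel, and a function $X/E\to Y/F$ is Borel if its graph is a Borel relation. A countable Borel equivalence relation $R$ on $(X,E)$ (Borel as a relation, with countable classes) has \emph{index} $n$ if all its classes have exactly $n$ elements; it is \emph{smooth} if it has a Borel transversal, i.e. a Borel set $T\subseteq X/E$ meeting every class in exactly one point; a \emph{Borel selector} for it is a Borel map $\varphi:X/E\to X/E$ with $a\mathrel{R}\varphi(a)$ for all $a$ and $\varphi(a)=\varphi(b)$ whenever $a\mathrel{R}b$; it is \emph{generated} by a map $f$ if it is the smallest equivalence relation containing the graph of $f$; it is \emph{Borel enumerable} if it is the union of the graphs of countably many Borel maps $f_n:X/E\to X/E$ $(n\in\mathbb N)$. An equivalence relation on a standard Borel space is \emph{smooth} if it is Borel reducible to equality on some standard Borel space. For equivalence relations $E\subseteq F$ on $X$, $F/E$ denotes the induced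 equivalence relation on $X/E$. Let $E_0$ be the relation of eventual equality on $2^{\omega}$, let $S_2$ act componentwise on $2^\omega$, $\sigma\cdot(x_n)=(\sigma x_n)$, and let $E_0(S_2)$ be the equivalence relation generated by $E_0$ and the orbit equivalence relation of this action. Let $\mu$ be the image on $2^\omega/E_0$ of the $\omega$-th power of the $(\frac12,\frac12)$-measure on $\{0,1\}$. (1) $(2^\omega,E_0)$ is a quotient Borel space, $E_0$ is not smooth, and $\mu$ is a probability measure that takes only the values $0$ and $1$ on Borel sets and vanishes on points. The action of $S_2$ preserves $E_0$; the induced action on $(2^\omega,E_0)$ is by Borel automorphisms, free and $\mu$-preserving, and its orbit equivalence relation is $E_0(S_2)/E_0$. The relation $E_0(S_2)/E_0$ is a countable Borel equivalence relation of index $2$ on $(2^\omega,E_0)$ that is not smooth. (2) On $X=2^\omega\times\{0,1\}$ consider $E=E_0(S_2)\oplus E_0$ and $F=E_0(S_2)\times I(2)$, that is, $$(x,i)\mathrel{E}(y,j)\iff \bigl(i=j=0\text{ and }x\mathrel{E_0(S_2)}y\bigr)\text{ or }\bigl(i=j=1\text{ and }x\mathrel{E_0}y\bigr),\qquad (x,i)\mathrel{F}(y,j)\iff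 x\mathrel{E_0(S_2)}y .$$ Then $E\subseteq F$ are countable Borel equivalence relations on $X$, and $F/E$ is a countable Borel equivalence relation of index $3$ on $(X,E)$. It is smooth: $(2^\omega\times\{0\})/E$ is a Borel transversal, and the map $\varphi$ of $X/E$ induced by $(x,i)\mapsto(x,0)$ is a Borel selector for $F/E$. Moreover $F/E$ is generated by the single Borel map $\varphi$, all of whose nonempty fibres have exactly three points. Nevertheless $F/E$ is not Borel enumerable. -/

import Mathlib

open MeasureTheory

namespace QuotientBorel

/-! ### Quotient Borel spaces -/

/-- `(X, E)` is a quotient Borel space: `X` is standard Borel and `E` is a countable Borel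
equivalence relation on `X`. The underlying set is `Quotient E`, and its Borel subsets are the
measurable sets of the quotient σ-algebra (Mathlib's instance on `Quotient E`). -/
structure IsQuotientBorelSpace (X : Type*) [MeasurableSpace X] (E : Setoid X) : Prop where
  standard : StandardBorelSpace X
  borel : MeasurableSet {p : X × X | E p.1 p.2}
  countable : ∀ x : X, {y : X | E x y}.Countable

/-- Smoothness of an equivalence relation on a standard Borel space: Borel reducibility to
equality on some standard Borel space. -/
def IsSmooth {X : Type*} [MeasurableSpace X] (E : Setoid X) : Prop :=
  ∃ (Y : Type) (_ : MeasurableSpace Y) (_ : StandardBorelSpace Y) (f : X → Y),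
    Measurable f ∧ ∀ x y : X, E x y ↔ f x = f y

section Relations

variable {X Y : Type*} [MeasurableSpace X] [MeasurableSpace Y] {E : Setoid X} {F : Setoid Y}

/-- A Borel binary relation between `(X, E)` and `(Y, F)`: a Borel subset of the product space
`(X × Y, E × F)`, that is, one whose preimage in `X × Y` is Borel. (This is in general weaker
than measurability for the product of the two quotient σ-algebras.) -/
def IsBorelRel (R : Quotient E → Quotient F → Prop) : Prop :=
  MeasurableSet {p : X × Y | R (Quotient.mk E p.1) (Quotient.mk F p.2)}

/-- A Borel function `(X, E) → (Y, F)`: its graph is a Borel relation. -/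
def IsBorelFun (f : Quotient E → Quotient F) : Prop :=
  IsBorelRel fun a b => f a = b

/-- A Borel automorphism of `(X, E)`. -/
def IsBorelAut (e : Equiv.Perm (Quotient E)) : Prop :=
  IsBorelFun (e : Quotient E → Quotient E) ∧ IsBorelFun (e.symm : Quotient E → Quotient E)

/-- A Borel action of a group on `(X, E)`: every group element acts as a Borel automorphism. -/
def IsBorelAction (E : Setoid X) (Γ : Type*) [Group Γ] [MulAction Γ (Quotient E)] : Prop :=
  ∀ γ : Γ, IsBorelAut (MulAction.toPerm γ : Equiv.Perm (Quotient E))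

/-- A countable Borel equivalence relation on the quotient Borel space `(X, E)`. -/
structure IsCountableBorelOver (R : Setoid (Quotient E)) : Prop where
  borel : IsBorelRel fun a b => R a b
  countable : ∀ a, {b | R a b}.Countable

/-- Every class of `R` has exactly `n` elements. -/
def HasIndex {A : Type*} (R : Setoid A) (n : ℕ) : Prop :=
  ∀ a, {b | R a b}.encard = n

/-- `T` is a Borel transversal for `R`: a Borel subset of `(X, E)` that meets every class of `R`
in exactly one point. -/
def IsBorelTransversal (R : Setoid (Quotient E)) (T : Set (Quotient E)) : Prop :=
  MeasurableSet T ∧ ∀ a, ∃! b, b ∈ T ∧ R a b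

/-- Smoothness of a countable Borel equivalence relation on a quotient Borel space. -/
def IsSmoothOver (R : Setoid (Quotient E)) : Prop :=
  ∃ T, IsBorelTransversal R T

/-- `φ` is a Borel selector for `R`. -/
def IsBorelSelector (R : Setoid (Quotient E)) (φ : Quotient E → Quotient E) : Prop :=
  IsBorelFun φ ∧ (∀ a, R a (φ a)) ∧ ∀ a b, R a b → φ a = φ b

/-- `R` is the smallest equivalence relation containing (the graph of) `f`. -/
def IsGeneratedBy {A : Type*} (R : Setoid A) (f : A → A) : Prop :=
  IsLeast {S : Setoid A | ∀ a, S a (f a)} R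

/-- `R` is Borel enumerable: the union of the graphs of countably many Borel endomorphisms. -/
def IsEnumerable (R : Setoid (Quotient E)) : Prop :=
  ∃ f : ℕ → Quotient E → Quotient E, (∀ n, IsBorelFun (f n)) ∧ ∀ a b, R a b ↔ ∃ n, f n a = b

end Relations

/-- For equivalence relations `E ⊆ F` on `X`, the equivalence relation `F / E` on `X / E`. -/
def quotientRel {X : Type*} (E F : Setoid X) (h : E ≤ F) : Setoid (Quotient E) :=
  Setoid.ker (Quotient.map' (s₁ := E) (s₂ := F) id h)

theorem quotientRel_mk {X : Type*} {E F : Setoid X} (h : E ≤ F) (x y : X) :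
    quotientRel E F h (Quotient.mk E x) (Quotient.mk E y) ↔ F x y :=
  Quotient.eq (r := F) (x := x) (y := y)

/-! ### The relation `E₀` and the componentwise action of `S₂` -/

/-- The Cantor space. -/
abbrev Cantor : Type := ℕ → Fin 2

/-- The symmetric group on two elements. Its action on `Cantor` is Mathlib's pointwise one:
`(σ • x) n = σ (x n)`. -/
abbrev S2 : Type := Equiv.Perm (Fin 2)

/-- Eventual equality of binary sequences. -/
def E0 : Setoid Cantor where
  r x y := ∃ n₀, ∀ n ≥ n₀, x n = y n
  iseqv :=
    { refl := fun _ => ⟨0, fun _ _ => rfl⟩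
      symm := fun ⟨k, h⟩ => ⟨k, fun n hn => (h n hn).symm⟩
      trans := fun ⟨k, h⟩ ⟨l, h'⟩ => ⟨max k l, fun n hn =>
        (h n (le_trans (le_max_left k l) hn)).trans (h' n (le_trans (le_max_right k l) hn))⟩ }

theorem E0_smul (σ : S2) {x y : Cantor} (h : E0 x y) : E0 (σ • x) (σ • y) := by
  obtain ⟨k, hk⟩ := h
  exact ⟨k, fun n hn => congrArg σ (hk n hn)⟩

/-- The action of `S₂` on `(2^ω, E₀)` induced by the componentwise action. -/
instance instMulActionQuotientE0 : MulAction S2 (Quotient E0) where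
  smul σ := Quotient.map (fun x => σ • x) fun _ _ h => E0_smul σ h
  one_smul a := Quotient.inductionOn a fun _ => rfl
  mul_smul _ _ a := Quotient.inductionOn a fun _ => rfl

/-- `E₀(S₂)`: the equivalence relation generated by `E₀` and the orbit equivalence relation of the
componentwise action of `S₂`. -/
def E0S2 : Setoid Cantor := E0 ⊔ MulAction.orbitRel S2 Cantor

theorem E0_le_E0S2 : E0 ≤ E0S2 := le_sup_left

/-- Haar measure on the Cantor space: the `ω`-th power of the uniform measure on `{0, 1}`. -/
noncomputable def haarCantor : Measure Cantor :=
  Measure.infinitePi fun _ : ℕ => (PMF.uniformOfFintype (Fin 2)).toMeasure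

/-- The quotient measure on `(2^ω, E₀)`. -/
noncomputable def quotientHaar : Measure (Quotient E0) :=
  haarCantor.map (Quotient.mk E0)

/-! ### The relations `E ⊆ F` on `2^ω × 2` -/

/-- `E = E₀(S₂) ⊕ E₀` on `2^ω × 2`. -/
def relE : Setoid (Cantor × Fin 2) where
  r p q := (p.2 = 0 ∧ q.2 = 0 ∧ E0S2 p.1 q.1) ∨ (p.2 = 1 ∧ q.2 = 1 ∧ E0 p.1 q.1)
  iseqv :=
    { refl := by
        rintro ⟨x, i⟩
        rcases Fin.exists_fin_two.mp ⟨i, rfl⟩ with h | h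
        · exact Or.inl ⟨h, h, E0S2.refl x⟩
        · exact Or.inr ⟨h, h, E0.refl x⟩
      symm := by
        rintro p q (⟨h, h', k⟩ | ⟨h, h', k⟩)
        · exact Or.inl ⟨h', h, E0S2.symm k⟩
        · exact Or.inr ⟨h', h, E0.symm k⟩
      trans := by
        rintro p q r (⟨h, h', k⟩ | ⟨h, h', k⟩) (⟨l, l', m⟩ | ⟨l, l', m⟩)
        · exact Or.inl ⟨h, l', E0S2.trans k m⟩
        · exact absurd (h'.symm.trans l) (by decide)
        · exact absurd (h'.symm.trans l) (by decide)
        · exact Or.inr ⟨h, l', E0.trans k m⟩ }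

/-- `F = E₀(S₂) × I(2)` on `2^ω × 2`, that is, `(x, i) F (y, j) ↔ x E₀(S₂) y`. -/
def relF : Setoid (Cantor × Fin 2) := E0S2.comap Prod.fst

theorem relE_le_relF : relE ≤ relF := by
  rintro p q (⟨_, _, h⟩ | ⟨_, _, h⟩)
  · exact h
  · exact E0_le_E0S2 h

/-- The self-map of `(2^ω × 2, E)` induced by `(x, i) ↦ (x, 0)`. -/
def selectorMap : Quotient relE → Quotient relE :=
  Quotient.map (fun p => (p.1, 0)) fun p q h =>
    Or.inl ⟨rfl, rfl, (relE_le_relF h : relF p q)⟩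

end QuotientBorel

open QuotientBorel

namespace QuotientBorel

/-! ### The group `S₂` and its action on the Cantor space -/

/-! Everything negative comes from ergodicity. An `E0`-invariant Borel set lies in the tail
σ-algebra, so Kolmogorov's law gives it Haar measure 0 or 1 (`haarCantor_eq_zero_or_one`). The flip
preserves Haar measure, so such a set cannot have measure 1 if it is disjoint from its flip
(`haarCantor_eq_zero_of_flip`).

The flip acts freely on `E0`-classes and each `E0S2`-class is the union of an `E0`-class and its
flip, which gives index 2. A Borel transversal of `E0S2` over `E0` would be null, and so would its
flip, yet together they cover the space.

For `F/E`, each class is one point at level 0 and two points at level 1 interchanged by the flip.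
Collapsing to level 0 is canonical, hence the selector and smoothness. Going back up is not: a map
from level 0 sees only the `E0S2`-class, so it must choose between the two points above. The set of
`x` where it chooses the class of `x` is `E0`-invariant and disjoint from its flip, hence null, and
countably many such sets cannot cover the space. -/

/-- The nontrivial element of `S₂`. -/
def flip : S2 := Equiv.swap 0 1

theorem flip_apply_ne (i : Fin 2) : flip i ≠ i := by
  revert i; decide

theorem eq_one_or_eq_flip (σ : S2) : σ = 1 ∨ σ = flip := by
  revert σ; decide

theorem measurable_smul_cantor (σ : S2) : Measurable fun x : Cantor => σ • x :=
  measurable_pi_lambda _ fun n => (measurable_of_finite σ).comp (measurable_pi_apply n)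

theorem not_E0_flip_smul (x : Cantor) : ¬ E0 x (flip • x) := by
  rintro ⟨k, hk⟩
  exact flip_apply_ne (x k) (hk k le_rfl).symm

theorem E0_smul_left_iff (σ : S2) (x y : Cantor) : E0 (σ • x) y ↔ E0 x (σ⁻¹ • y) := by
  constructor
  · intro h
    simpa using E0_smul σ⁻¹ h
  · intro h
    simpa using E0_smul σ h

/-- The action preserves `E0`, so group elements can be moved past `E0`-steps: a chain of `E0`- and
orbit-steps collapses to one group element followed by one `E0`-step. The right-hand side is thus
already transitive and is the join. -/
theorem E0S2_iff_exists_smul {x y : Cantor} : E0S2 x y ↔ ∃ σ : S2, E0 (σ • x) y := by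
  constructor
  · let S : Setoid Cantor :=
      { r := fun x y => ∃ σ : S2, E0 (σ • x) y
        iseqv :=
          { refl := fun x => ⟨1, by rw [one_smul]⟩
            symm := fun {x y} ⟨σ, h⟩ => ⟨σ⁻¹, E0.symm ((E0_smul_left_iff σ x y).mp h)⟩
            trans := fun {x y z} ⟨σ, h⟩ ⟨τ, h'⟩ =>
              ⟨τ * σ, by rw [mul_smul]; exact E0.trans (E0_smul τ h) h'⟩ } }
    have hS : E0S2 ≤ S := by
      refine sup_le (fun {x y} h => ⟨1, by rwa [one_smul]⟩) fun {x y} h => ?_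
      obtain ⟨σ, rfl⟩ := MulAction.orbitRel_apply.mp h
      exact ⟨σ⁻¹, by rw [inv_smul_smul]⟩
    exact fun h => hS h
  · rintro ⟨σ, h⟩
    refine E0S2.trans ?_ (E0_le_E0S2 h)
    have hσ : MulAction.orbitRel S2 Cantor (σ • x) x :=
      MulAction.orbitRel_apply.mpr (MulAction.mem_orbit x σ)
    exact E0S2.symm ((le_sup_right : _ ≤ E0S2) hσ)

theorem E0S2_iff {x y : Cantor} : E0S2 x y ↔ E0 x y ∨ E0 (flip • x) y := by
  rw [E0S2_iff_exists_smul]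
  constructor
  · rintro ⟨σ, h⟩
    rcases eq_one_or_eq_flip σ with rfl | rfl
    · exact Or.inl (by rwa [one_smul] at h)
    · exact Or.inr h
  · rintro (h | h)
    · exact ⟨1, by rwa [one_smul]⟩
    · exact ⟨flip, h⟩

theorem E0S2_flip_smul (x : Cantor) : E0S2 x (flip • x) :=
  E0S2_iff.mpr (Or.inr (E0.refl _))

/-! ### Borelness and countability -/

theorem measurableSet_E0 : MeasurableSet {p : Cantor × Cantor | E0 p.1 p.2} := by
  have h : {p : Cantor × Cantor | E0 p.1 p.2} =
      ⋃ k : ℕ, ⋂ n : ℕ, ⋂ _ : k ≤ n, {p : Cantor × Cantor | p.1 n = p.2 n} := by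
    ext p
    simp only [Set.mem_iUnion, Set.mem_iInter, Set.mem_ofPred_eq]
    rfl
  rw [h]
  exact .iUnion fun k => .iInter fun n => .iInter fun _ =>
    measurableSet_eq_fun ((measurable_pi_apply n).comp measurable_fst)
      ((measurable_pi_apply n).comp measurable_snd)

theorem measurableSet_E0_smul (σ : S2) :
    MeasurableSet {p : Cantor × Cantor | E0 (σ • p.1) p.2} :=
  (((measurable_smul_cantor σ).comp measurable_fst).prodMk measurable_snd) measurableSet_E0

theorem measurableSet_E0S2 : MeasurableSet {p : Cantor × Cantor | E0S2 p.1 p.2} := by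
  simp only [E0S2_iff, Set.ofPred_or]
  exact measurableSet_E0.union (measurableSet_E0_smul flip)

theorem countable_E0_class (x : Cantor) : {y | E0 x y}.Countable := by
  have h : {y | E0 x y} ⊆ ⋃ k : ℕ,
      -- A member of the class is determined by `k` and its first `k` values, the rest being copied
      -- from `x`.
      Set.range fun (s : Fin k → Fin 2) (n : ℕ) => if hn : n < k then s ⟨n, hn⟩ else x n := by
    rintro y ⟨k, hk⟩
    refine Set.mem_iUnion.mpr ⟨k, fun i => y i, funext fun n => ?_⟩
    by_cases hn : n < k
    · simp [hn]
    · simp [hn, hk n (not_lt.mp hn)]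
  exact (Set.countable_iUnion fun k => Set.countable_range _).mono h

theorem countable_E0S2_class (x : Cantor) : {y | E0S2 x y}.Countable := by
  simp only [E0S2_iff, Set.ofPred_or]
  exact (countable_E0_class x).union (countable_E0_class _)

theorem isQuotientBorelSpace_E0 : IsQuotientBorelSpace Cantor E0 :=
  ⟨inferInstance, measurableSet_E0, countable_E0_class⟩

/-- A countable Borel equivalence relation `F ⊇ E` induces one on `(X, E)`. -/
theorem isCountableBorelOver_quotientRel {X : Type*} [MeasurableSpace X] {E F : Setoid X}
    (h : E ≤ F) (hF : IsQuotientBorelSpace X F) : IsCountableBorelOver (quotientRel E F h) where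
  borel := by
    simpa only [IsBorelRel, quotientRel_mk] using hF.borel
  countable a := by
    induction a using Quotient.inductionOn with | _ x => ?_
    refine ((hF.countable x).image (Quotient.mk E)).mono fun b hb => ?_
    induction b using Quotient.inductionOn with | _ y => ?_
    exact ⟨y, (quotientRel_mk h x y).mp hb, rfl⟩

theorem isQuotientBorelSpace_E0S2 : IsQuotientBorelSpace Cantor E0S2 :=
  ⟨inferInstance, measurableSet_E0S2, countable_E0S2_class⟩

/-! ### Haar measure -/

instance isProbabilityMeasure_haarCantor : IsProbabilityMeasure haarCantor :=
  inferInstanceAs (IsProbabilityMeasure (Measure.infinitePi _))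

theorem map_smul_haarCantor (σ : S2) : haarCantor.map (fun x => σ • x) = haarCantor := by
  have h : (PMF.uniformOfFintype (Fin 2)).toMeasure.map σ =
      (PMF.uniformOfFintype (Fin 2)).toMeasure := by
    refine Measure.ext_of_singleton fun i => ?_
    have hi : σ ⁻¹' {i} = {σ.symm i} := by
      ext j; simp [Equiv.eq_symm_apply]
    rw [Measure.map_apply (measurable_of_finite σ) (measurableSet_singleton i), hi,
      PMF.toMeasure_apply_singleton _ _ (measurableSet_singleton _),
      PMF.toMeasure_apply_singleton _ _ (measurableSet_singleton _)]
    simp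
  refine (Measure.infinitePi_map_pi _ fun _ : ℕ => measurable_of_finite σ).trans ?_
  simp only [h]
  rfl

theorem measurePreserving_smul_haarCantor (σ : S2) :
    MeasurePreserving (fun x : Cantor => σ • x) haarCantor haarCantor :=
  ⟨measurable_smul_cantor σ, map_smul_haarCantor σ⟩

theorem haarCantor_singleton (x : Cantor) : haarCantor {x} = 0 := by
  have h (k : ℕ) : haarCantor {x} ≤ (2⁻¹ : ENNReal) ^ k := by
    -- The point lies in the cylinder fixing its first `k` coordinates, of measure `2⁻¹ ^ k`.
    have hsub : ({x} : Set Cantor) ⊆ Set.pi (Finset.range k : Set ℕ) fun n => {x n} := by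
      rintro _ rfl n _
      rfl
    refine (measure_mono hsub).trans_eq ?_
    rw [haarCantor, Measure.infinitePi_pi _ fun n _ => measurableSet_singleton _]
    simp
  refine le_antisymm (ge_of_tendsto' (ENNReal.tendsto_pow_atTop_nhds_zero_of_lt_one ?_) h) zero_le
  simp

instance noAtoms_haarCantor : NullSingletonClass haarCantor := ⟨haarCantor_singleton⟩

/-- `E₀`-invariant Borel sets have Haar measure `0` or `1`. -/
theorem haarCantor_eq_zero_or_one {B : Set Cantor} (hB : MeasurableSet B)
    (hinv : ∀ x y, E0 x y → x ∈ B → y ∈ B) : haarCantor B = 0 ∨ haarCantor B = 1 := by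
  let s : ℕ → MeasurableSpace Cantor := fun n =>
    MeasurableSpace.comap (fun x : Cantor => x n) inferInstance
  have hs (n : ℕ) : s n ≤ MeasurableSpace.pi := (measurable_pi_apply n).comap_le
  have hind : ProbabilityTheory.iIndep s haarCantor :=
    ProbabilityTheory.iIndepFun_infinitePi (X := fun _ i => i) fun _ => measurable_id
  refine ProbabilityTheory.measure_zero_or_one_of_measurableSet_limsup_atTop hs hind ?_
  rw [Filter.limsup_eq_iInf_iSup_of_nat, MeasurableSpace.measurableSet_iInf]
  intro k
  -- Erasing the first `k` coordinates stays in the same `E0`-class, so `B = g ⁻¹' B`; since `g`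
  -- depends only on coordinates from `k` on, `B` belongs to the σ-algebra they generate, for every
  -- `k`.
  let g : Cantor → Cantor := fun x n => if k ≤ n then x n else 0
  have hg : Measurable[⨆ i, ⨆ _ : k ≤ i, s i] g := by
    refine @measurable_pi_lambda _ _ _ (_) _ _ fun n => ?_
    by_cases hn : k ≤ n
    · have : (fun x => g x n) = fun x : Cantor => x n := by
        ext x; simp [g, hn]
      rw [this]
      exact (comap_measurable _).mono (le_iSup₂_of_le (f := fun i (_ : k ≤ i) => s i) n hn le_rfl)
        le_rfl
    · have : (fun x => g x n) = fun _ : Cantor => (0 : Fin 2) := by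
        ext x; simp [g, hn]
      rw [this]
      exact measurable_const
  have hgE (x : Cantor) : E0 x (g x) := ⟨k, fun n hn => by simp [g, hn]⟩
  have hBg : B = g ⁻¹' B := by
    ext x
    exact ⟨hinv _ _ (hgE x), hinv _ _ (E0.symm (hgE x))⟩
  rw [hBg]
  exact hg hB

/-- An `E₀`-invariant Borel set disjoint from its image under the flip is null. -/
theorem haarCantor_eq_zero_of_flip {B : Set Cantor} (hB : MeasurableSet B)
    (hinv : ∀ x y, E0 x y → x ∈ B → y ∈ B) (hflip : ∀ x ∈ B, flip • x ∉ B) :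
    haarCantor B = 0 := by
  refine (haarCantor_eq_zero_or_one hB hinv).resolve_right fun h => ?_
  -- If `B` had measure 1, its flip preimage would also have measure 1 while lying in the null set
  -- `Bᶜ`.
  have hp := (measurePreserving_smul_haarCantor flip).measure_preimage hB.nullMeasurableSet
  have hsub : (fun x : Cantor => flip • x) ⁻¹' B ⊆ Bᶜ := fun x hx hxB => hflip x hxB hx
  have := measure_mono (μ := haarCantor) hsub
  rw [hp, (prob_compl_eq_zero_iff hB).mpr h, h] at this
  simp at this

/-- By ergodicity a Borel reduction to equality is almost everywhere constant, so a single
`E0`-class would be conull; but classes are countable and points are null. -/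
theorem not_isSmooth_E0 : ¬ IsSmooth E0 := by
  rintro ⟨Y, _, _, f, hf, hE⟩
  -- Coding `Y` by bit sequences makes each bit of the reduction the indicator of an invariant Borel
  -- set, to which the zero-one law applies.
  obtain ⟨g, hg, hginj⟩ := MeasurableSpace.measurable_injection_nat_bool_of_countablySeparated Y
  have hconst (n : ℕ) : ∃ c : Bool, ∀ᵐ x ∂haarCantor, g (f x) n = c := by
    have hm : MeasurableSet {x | g (f x) n = true} :=
      ((measurable_pi_apply n).comp (hg.comp hf)) (measurableSet_singleton true)
    rcases haarCantor_eq_zero_or_one hm fun x y hxy hx => by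
      simpa only [Set.mem_ofPred_eq, ← (hE x y).mp hxy] using hx with h | h
    · refine ⟨false, ?_⟩
      rw [ae_iff]
      simpa using h
    · exact ⟨true, (prob_compl_eq_zero_iff hm).mpr h⟩
  choose c hc using hconst
  have hall : ∀ᵐ x ∂haarCantor, g (f x) = c := by
    filter_upwards [ae_all_iff.mpr hc] with x hx using funext hx
  obtain ⟨x₀, hx₀⟩ := hall.exists
  have hclass : ∀ᵐ x ∂haarCantor, E0 x₀ x := by
    filter_upwards [hall] with x hx
    exact (hE x₀ x).mpr (hginj (hx₀.trans hx.symm))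
  have hnot : ∀ᵐ x ∂haarCantor, ¬ E0 x₀ x := by
    rw [ae_iff]
    simpa using (countable_E0_class x₀).measure_zero haarCantor
  obtain ⟨x, hx, hx'⟩ := (hclass.and hnot).exists
  exact hx' hx

theorem measurable_mk_E0 : Measurable (Quotient.mk E0) := measurable_quotient_mk''

theorem quotientHaar_apply {A : Set (Quotient E0)} (hA : MeasurableSet A) :
    quotientHaar A = haarCantor (Quotient.mk E0 ⁻¹' A) :=
  Measure.map_apply measurable_mk_E0 hA

theorem mem_preimage_mk_of_rel {X : Type*} {E : Setoid X} (A : Set (Quotient E)) (x y : X)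
    (h : E x y) (hx : x ∈ Quotient.mk E ⁻¹' A) : y ∈ Quotient.mk E ⁻¹' A := by
  rwa [Set.mem_preimage, ← Quotient.sound (s := E) h]

theorem quotientHaar_singleton (a : Quotient E0) : quotientHaar {a} = 0 := by
  induction a using Quotient.inductionOn with | _ x => ?_
  have h : (Quotient.mk E0 ⁻¹' {Quotient.mk E0 x}).Countable :=
    (countable_E0_class x).mono fun y hy => E0.symm (Quotient.exact hy)
  have hm : MeasurableSet ({Quotient.mk E0 x} : Set (Quotient E0)) :=
    measurableSet_quotient.mpr h.measurableSet
  rw [quotientHaar_apply hm]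
  exact h.measure_zero _

/-! ### The action of `S₂` on `(2^ω, E₀)` -/

theorem smul_mk_E0 (σ : S2) (x : Cantor) : σ • Quotient.mk E0 x = Quotient.mk E0 (σ • x) := rfl

theorem isBorelFun_smul (σ : S2) : IsBorelFun fun a : Quotient E0 => σ • a := by
  simpa only [IsBorelFun, IsBorelRel, smul_mk_E0, Quotient.eq] using measurableSet_E0_smul σ

theorem isBorelAction_S2 : IsBorelAction E0 S2 := fun σ =>
  ⟨isBorelFun_smul σ, isBorelFun_smul σ⁻¹⟩

theorem flip_smul_ne (a : Quotient E0) : flip • a ≠ a := by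
  induction a using Quotient.inductionOn with | _ x => ?_
  exact fun h => not_E0_flip_smul x (E0.symm (Quotient.exact h))

theorem eq_one_of_smul_eq (σ : S2) (a : Quotient E0) (h : σ • a = a) : σ = 1 :=
  (eq_one_or_eq_flip σ).resolve_right fun hσ => flip_smul_ne a (hσ ▸ h)

theorem measurePreserving_smul_quotientHaar (σ : S2) :
    MeasurePreserving (fun a : Quotient E0 => σ • a) quotientHaar quotientHaar := by
  have hm : Measurable fun a : Quotient E0 => σ • a :=
    measurable_from_quotient.mpr (measurable_mk_E0.comp (measurable_smul_cantor σ))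
  refine ⟨hm, ?_⟩
  rw [quotientHaar, Measure.map_map hm measurable_mk_E0]
  conv_rhs => rw [← map_smul_haarCantor σ, Measure.map_map measurable_mk_E0
    (measurable_smul_cantor σ)]
  rfl

theorem orbitRel_quotient_E0 :
    MulAction.orbitRel S2 (Quotient E0) = quotientRel E0 E0S2 E0_le_E0S2 := by
  ext a b
  induction a using Quotient.inductionOn with | _ x => ?_
  induction b using Quotient.inductionOn with | _ y => ?_
  rw [quotientRel_mk, MulAction.orbitRel_apply, MulAction.mem_orbit_iff]
  simp only [smul_mk_E0, Quotient.eq]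
  rw [← E0S2_iff_exists_smul]
  -- `orbitRel` puts its first argument in the orbit of the second, so the two sides differ by
  -- symmetry.
  exact ⟨E0S2.symm, E0S2.symm⟩

/-! ### The relation `E₀(S₂)/E₀` -/

theorem hasIndex_quotientRel_E0S2 : HasIndex (quotientRel E0 E0S2 E0_le_E0S2) 2 := by
  intro a
  have h : {b | quotientRel E0 E0S2 E0_le_E0S2 a b} = {a, flip • a} := by
    ext b
    induction a using Quotient.inductionOn with | _ x => ?_
    induction b using Quotient.inductionOn with | _ y => ?_
    simp only [Set.mem_ofPred_eq, quotientRel_mk, E0S2_iff, Set.mem_insert_iff,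
      Set.mem_singleton_iff, smul_mk_E0, Quotient.eq]
    exact or_congr ⟨E0.symm, E0.symm⟩ ⟨E0.symm, E0.symm⟩
  rw [h, Set.encard_pair (flip_smul_ne a).symm]
  rfl

theorem not_isSmoothOver_quotientRel_E0S2 :
    ¬ IsSmoothOver (quotientRel E0 E0S2 E0_le_E0S2) := by
  rintro ⟨T, hT, huniq⟩
  set B := Quotient.mk E0 ⁻¹' T
  have hB : MeasurableSet B := measurable_mk_E0 hT
  have hflip : ∀ x ∈ B, flip • x ∉ B := by
    intro x hx hx'
    refine not_E0_flip_smul x (Quotient.exact (s := E0) ?_)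
    exact (huniq (Quotient.mk E0 x)).unique ⟨hx, (quotientRel_mk _ _ _).mpr (E0S2.refl x)⟩
      ⟨hx', (quotientRel_mk _ _ _).mpr (E0S2_flip_smul x)⟩
  have h0 := haarCantor_eq_zero_of_flip hB (mem_preimage_mk_of_rel T) hflip
  have h1 := ((measurePreserving_smul_haarCantor flip).measure_preimage
    hB.nullMeasurableSet).trans h0
  have hcover : B ∪ (fun x : Cantor => flip • x) ⁻¹' B = Set.univ := by
    refine Set.eq_univ_of_forall fun x => ?_
    obtain ⟨b, ⟨hbT, hb⟩, -⟩ := huniq (Quotient.mk E0 x)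
    induction b using Quotient.inductionOn with | _ y => ?_
    rcases E0S2_iff.mp ((quotientRel_mk _ _ _).mp hb) with h | h
    · exact Or.inl (mem_preimage_mk_of_rel T _ _ (E0.symm h) hbT)
    · exact Or.inr (mem_preimage_mk_of_rel T _ _ (E0.symm h) hbT)
  have := measure_union_null h0 h1
  rw [hcover, measure_univ] at this
  exact one_ne_zero this

/-! ### The relations `E ⊆ F` on `2^ω × 2` -/

theorem relE_zero_iff {x y : Cantor} : relE (x, 0) (y, 0) ↔ E0S2 x y :=
  ⟨fun h => relE_le_relF h, fun h => Or.inl ⟨rfl, rfl, h⟩⟩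

theorem relE_one_iff {x y : Cantor} : relE (x, 1) (y, 1) ↔ E0 x y :=
  ⟨fun h => (h.resolve_left fun h => absurd h.1 one_ne_zero).2.2, fun h => Or.inr ⟨rfl, rfl, h⟩⟩

theorem snd_eq_of_relE {p q : Cantor × Fin 2} (h : relE p q) : p.2 = q.2 := by
  rcases h with h | h
  · exact h.1.trans h.2.1.symm
  · exact h.1.trans h.2.1.symm

theorem E0S2_fst_of_relE {p q : Cantor × Fin 2} (h : relE p q) : E0S2 p.1 q.1 :=
  relE_le_relF h

theorem isQuotientBorelSpace_relF : IsQuotientBorelSpace (Cantor × Fin 2) relF where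
  standard := inferInstance
  borel := ((measurable_fst.comp measurable_fst).prodMk
    (measurable_fst.comp measurable_snd)) measurableSet_E0S2
  countable p := ((countable_E0S2_class p.1).prod (Set.countable_univ (α := Fin 2))).mono
    fun _ hq => Set.mem_prod.mpr ⟨hq, Set.mem_univ _⟩

theorem isQuotientBorelSpace_relE : IsQuotientBorelSpace (Cantor × Fin 2) relE where
  standard := inferInstance
  borel := by
    have hproj : Measurable fun p : (Cantor × Fin 2) × Cantor × Fin 2 => (p.1.1, p.2.1) :=
      (measurable_fst.comp measurable_fst).prodMk (measurable_fst.comp measurable_snd)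
    have h₁ (i : Fin 2) : MeasurableSet {p : (Cantor × Fin 2) × Cantor × Fin 2 | p.1.2 = i} :=
      (measurable_snd.comp measurable_fst) (measurableSet_singleton i)
    have h₂ (i : Fin 2) : MeasurableSet {p : (Cantor × Fin 2) × Cantor × Fin 2 | p.2.2 = i} :=
      (measurable_snd.comp measurable_snd) (measurableSet_singleton i)
    exact ((h₁ 0).inter ((h₂ 0).inter (hproj measurableSet_E0S2))).union
      ((h₁ 1).inter ((h₂ 1).inter (hproj measurableSet_E0)))
  countable p := (isQuotientBorelSpace_relF.countable p).mono fun _ hq => relE_le_relF hq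

theorem selectorMap_mk (p : Cantor × Fin 2) :
    selectorMap (Quotient.mk relE p) = Quotient.mk relE (p.1, 0) := rfl

/-- At level 0, `relE` is already `E0S2`, so the selector forgets exactly as much as `F` does.
Uniqueness in the transversal, generation and the fibre count all follow from this. -/
theorem selectorMap_eq_iff (a b : Quotient relE) :
    selectorMap a = selectorMap b ↔ quotientRel relE relF relE_le_relF a b := by
  induction a using Quotient.inductionOn with | _ p => ?_
  induction b using Quotient.inductionOn with | _ q => ?_
  rw [selectorMap_mk, selectorMap_mk, Quotient.eq, relE_zero_iff, quotientRel_mk]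
  rfl

theorem rel_selectorMap (a : Quotient relE) :
    quotientRel relE relF relE_le_relF a (selectorMap a) := by
  induction a using Quotient.inductionOn with | _ p => ?_
  exact (quotientRel_mk _ _ _).mpr (E0S2.refl p.1)

theorem hasIndex_quotientRel_relF : HasIndex (quotientRel relE relF relE_le_relF) 3 := by
  intro a
  induction a using Quotient.inductionOn with | _ p => ?_
  obtain ⟨x, i⟩ := p
  have h : {b | quotientRel relE relF relE_le_relF (Quotient.mk relE (x, i)) b} =
      {Quotient.mk relE (x, 0), Quotient.mk relE (x, 1), Quotient.mk relE (flip • x, 1)} := by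
    ext b
    induction b using Quotient.inductionOn with | _ q => ?_
    obtain ⟨y, j⟩ := q
    simp only [Set.mem_ofPred_eq, quotientRel_mk, Set.mem_insert_iff, Set.mem_singleton_iff,
      Quotient.eq]
    constructor
    · intro (h : E0S2 x y)
      rcases Fin.exists_fin_two.mp ⟨j, rfl⟩ with rfl | rfl
      · exact Or.inl (relE_zero_iff.mpr (E0S2.symm h))
      · rcases E0S2_iff.mp h with h | h
        · exact Or.inr (Or.inl (relE_one_iff.mpr (E0.symm h)))
        · exact Or.inr (Or.inr (relE_one_iff.mpr (E0.symm h)))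
    · change _ → E0S2 x y
      rintro (h | h | h)
      · exact E0S2.symm (E0S2_fst_of_relE h)
      · exact E0S2.symm (E0S2_fst_of_relE h)
      · exact E0S2.trans (E0S2_flip_smul x) (E0S2.symm (E0S2_fst_of_relE h))
  have h₁ : Quotient.mk relE (x, 1) ≠ Quotient.mk relE (flip • x, 1) := fun h =>
    not_E0_flip_smul x (relE_one_iff.mp (Quotient.exact h))
  have h₀ (y : Cantor) : Quotient.mk relE (x, 0) ≠ Quotient.mk relE (y, 1) := fun h =>
    zero_ne_one (snd_eq_of_relE (Quotient.exact h))
  rw [h, Set.encard_insert_of_notMem (by simp only [Set.mem_insert_iff, Set.mem_singleton_iff,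
    h₀, or_self, not_false_eq_true]), Set.encard_pair h₁]
  norm_num

theorem encard_selectorMap_fibre (a : Quotient relE) :
    {b | selectorMap b = selectorMap a}.encard = 3 := by
  simp only [eq_comm (b := selectorMap a), selectorMap_eq_iff]
  exact hasIndex_quotientRel_relF a

theorem isBorelSelector_selectorMap :
    IsBorelSelector (quotientRel relE relF relE_le_relF) selectorMap := by
  refine ⟨?_, rel_selectorMap, fun a b h => (selectorMap_eq_iff a b).mpr h⟩
  simp only [IsBorelFun, IsBorelRel, selectorMap_mk, Quotient.eq]
  have hm : Measurable fun p : (Cantor × Fin 2) × Cantor × Fin 2 =>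
      ((p.1.1, (0 : Fin 2)), p.2) :=
    ((measurable_fst.comp measurable_fst).prodMk measurable_const).prodMk measurable_snd
  exact hm isQuotientBorelSpace_relE.borel

theorem isBorelTransversal_zero : IsBorelTransversal (quotientRel relE relF relE_le_relF)
    (Quotient.mk relE '' {p | p.2 = 0}) := by
  constructor
  · have h : Quotient.mk relE ⁻¹' (Quotient.mk relE '' {p | p.2 = 0}) = {p | p.2 = 0} := by
      ext p
      constructor
      · rintro ⟨q, hq, hqp⟩
        exact (snd_eq_of_relE (Quotient.exact hqp)).symm.trans hq
      · exact fun hp => ⟨p, hp, rfl⟩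
    refine measurableSet_quotient.mpr ?_
    change MeasurableSet (Quotient.mk relE ⁻¹' _)
    rw [h]
    exact measurable_snd (measurableSet_singleton 0)
  · intro a
    refine ⟨selectorMap a, ⟨?_, rel_selectorMap a⟩, ?_⟩
    · induction a using Quotient.inductionOn with | _ p => ?_
      exact ⟨(p.1, 0), rfl, rfl⟩
    · rintro _ ⟨⟨⟨y, j⟩, rfl, rfl⟩, h⟩
      exact ((selectorMap_eq_iff _ _).mpr h).symm

theorem isGeneratedBy_selectorMap :
    IsGeneratedBy (quotientRel relE relF relE_le_relF) selectorMap := by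
  refine ⟨rel_selectorMap, fun S hS a b h => ?_⟩
  -- Related points have a common image under the selector, through which `S` links them.
  have hb := S.symm (hS b)
  rw [← (selectorMap_eq_iff a b).mpr h] at hb
  exact S.trans (hS a) hb

/-- If Borel maps enumerated `F/E`, the sets of those `x` for which the `n`-th map sends `[(x, 0)]`
to `[(x, 1)]` would be null sets covering the Cantor space. -/
theorem not_isEnumerable_quotientRel_relF :
    ¬ IsEnumerable (quotientRel relE relF relE_le_relF) := by
  rintro ⟨f, hf, henum⟩
  let B : ℕ → Set Cantor := fun n =>
    {x | f n (Quotient.mk relE (x, 0)) = Quotient.mk relE (x, 1)}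
  have hB (n : ℕ) : MeasurableSet (B n) := by
    have hm : Measurable fun x : Cantor => ((x, (0 : Fin 2)), (x, (1 : Fin 2))) :=
      (measurable_id.prodMk measurable_const).prodMk (measurable_id.prodMk measurable_const)
    exact hm (hf n)
  have hzero {x y : Cantor} (h : E0S2 x y) : Quotient.mk relE (x, 0) = Quotient.mk relE (y, 0) :=
    Quotient.sound (relE_zero_iff.mpr h)
  have hnull (n : ℕ) : haarCantor (B n) = 0 := by
    refine haarCantor_eq_zero_of_flip (hB n) (fun x y hxy hx => ?_) fun x hx hx' => ?_
    · change f n _ = _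
      rw [← hzero (E0_le_E0S2 hxy), ← Quotient.sound (s := relE) (relE_one_iff.mpr hxy)]
      exact hx
    · change f n _ = _ at hx hx'
      -- `x` and its flip give the same level-0 point, so one value of `f n` would have to equal
      -- both distinct level-1 points.
      rw [← hzero (E0S2_flip_smul x), hx] at hx'
      exact not_E0_flip_smul x (relE_one_iff.mp (Quotient.exact hx'))
  have hcover : ⋃ n, B n = Set.univ := by
    refine Set.eq_univ_of_forall fun x => Set.mem_iUnion.mpr ?_
    -- The points `[(x, 0)]` and `[(x, 1)]` are `F/E`-related, so some `f n` takes the first to the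
    -- second.
    exact (henum _ _).mp ((quotientRel_mk _ _ _).mpr (E0S2.refl x))
  have := measure_iUnion_null hnull
  rw [hcover, measure_univ] at this
  exact one_ne_zero this

end QuotientBorel

theorem mainTheorem4 :
    -- `(2^ω, E₀)` is a nonsmooth quotient Borel space, and its quotient Haar measure is
    -- two-valued (ergodicity) and nonatomic
    (IsQuotientBorelSpace Cantor E0 ∧ ¬ IsSmooth E0 ∧
      (∀ A : Set (Quotient E0), MeasurableSet A → quotientHaar A = 0 ∨ quotientHaar A = 1) ∧
      quotientHaar Set.univ = 1 ∧
      (∀ a : Quotient E0, quotientHaar {a} = 0)) ∧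
    -- the induced `S₂`-action on `(2^ω, E₀)` is Borel, free and measure preserving, and its orbit
    -- equivalence relation is `E₀(S₂)/E₀`
    (IsBorelAction E0 S2 ∧
      (∀ (σ : S2) (a : Quotient E0), σ • a = a → σ = 1) ∧
      (∀ σ : S2, MeasurePreserving (fun a : Quotient E0 => σ • a) quotientHaar quotientHaar) ∧
      MulAction.orbitRel S2 (Quotient E0) = quotientRel E0 E0S2 E0_le_E0S2) ∧
    -- `E₀(S₂)/E₀` is a nonsmooth countable Borel equivalence relation of index 2
    (IsCountableBorelOver (quotientRel E0 E0S2 E0_le_E0S2) ∧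
      HasIndex (quotientRel E0 E0S2 E0_le_E0S2) 2 ∧
      ¬ IsSmoothOver (quotientRel E0 E0S2 E0_le_E0S2)) ∧
    -- `E` and `F` are countable Borel equivalence relations on the standard Borel space `2^ω × 2`,
    -- and `F/E` is a countable Borel equivalence relation of index 3 on `(2^ω × 2, E)`
    (IsQuotientBorelSpace (Cantor × Fin 2) relE ∧
      IsQuotientBorelSpace (Cantor × Fin 2) relF ∧
      IsCountableBorelOver (quotientRel relE relF relE_le_relF) ∧
      HasIndex (quotientRel relE relF relE_le_relF) 3) ∧
    -- `F/E` is smooth: `(2^ω × {0})/E` is a Borel transversal, and `(x, i) ↦ (x, 0)` induces a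
    -- Borel selector
    (IsSmoothOver (quotientRel relE relF relE_le_relF) ∧
      IsBorelTransversal (quotientRel relE relF relE_le_relF)
        (Quotient.mk relE '' {p | p.2 = 0}) ∧
      IsBorelSelector (quotientRel relE relF relE_le_relF) selectorMap) ∧
    -- `F/E` is generated by this single Borel map, which is 3-to-1 onto its range
    (IsGeneratedBy (quotientRel relE relF relE_le_relF) selectorMap ∧
      ∀ a, {b | selectorMap b = selectorMap a}.encard = 3) ∧
    -- `F/E` is not Borel enumerable
    ¬ IsEnumerable (quotientRel relE relF relE_le_relF) := by
  refine ⟨⟨isQuotientBorelSpace_E0, not_isSmooth_E0, fun A hA => ?_, ?_, quotientHaar_singleton⟩,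
    ⟨isBorelAction_S2, eq_one_of_smul_eq, measurePreserving_smul_quotientHaar,
      orbitRel_quotient_E0⟩,
    ⟨isCountableBorelOver_quotientRel _ isQuotientBorelSpace_E0S2, hasIndex_quotientRel_E0S2,
      not_isSmoothOver_quotientRel_E0S2⟩,
    ⟨isQuotientBorelSpace_relE, isQuotientBorelSpace_relF,
      isCountableBorelOver_quotientRel _ isQuotientBorelSpace_relF, hasIndex_quotientRel_relF⟩,
    ⟨⟨_, isBorelTransversal_zero⟩, isBorelTransversal_zero, isBorelSelector_selectorMap⟩,
    ⟨isGeneratedBy_selectorMap, encard_selectorMap_fibre⟩, not_isEnumerable_quotientRel_relF⟩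
  · rw [quotientHaar_apply hA]
    exact haarCantor_eq_zero_or_one (measurable_mk_E0 hA) (mem_preimage_mk_of_rel A)
  · rw [quotientHaar_apply .univ, Set.preimage_univ, measure_univ]
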